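/- For every integer $m\ge 1$ there is an integer $N=N(m)$ such that the following holds for all $n\ge N$. Let the edges of the complete graph $K_n$ be labelled by a map $\sigma:E(K_n)\to\mathbb F_2^m$; the multisign of a circle (simple cycle) $C$ is $\sigma(C)=\sum_{e\in E(C)}\sigma(e)$, and $\eta(g)$ denotes the number of triangles with multisign $g$. Let $\mathcal S$ be the set of multisigns $\sigma(H)$ of all Hamiltonian circles $H$ of $K_n$. Suppose that $x_1,\dots,x_m\in\mathbb F_2^m$ are linearly independent, that the multisign of every triangle lies in $\{x_1,\dots,x_m\}$, and that $\eta(x_1)\ge\eta(x_i)$ for all $i$. (a) If every $x_i$ is the multisign of some triangle, then, with $U=\operatorname{span}\{x_i+x_1 : 2\le i\le m\}$, we have $\mathcal S=U$ if $n$ is even and $\mathcal S=x_1+U$ if $n$ is odd. (b) In general the same holds with $U$ replaced by $U'=\operatorname{span}\{x_i+x_1 : 2\le i\le m,\ \eta(x_i)>0\}$: we have $\mathcal S=U'$ if $n$ is even and $\mathcal S=x_1+U'$ if $n$ is odd. In particular $\mathcal S$ is a subspace of $\mathbb F_2^m$ if $n$ is even and an affine subspace if $n$ is odd. -/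

import Mathlib

/-- A multisigned complete graph `(K_V, σ, 𝔽₂ᵐ)` on the vertex set `V`: every edge of the complete
graph carries a vector of `𝔽₂ᵐ`. The edges are the non-diagonal unordered pairs; the values on the
diagonal of `Sym2 V` are never used. -/
abbrev Multisigning (V : Type*) (m : ℕ) : Type _ := Sym2 V → (Fin m → ZMod 2)

namespace Multisigning

variable {V : Type*} {m : ℕ}

/-- The multisign of a circle, given as a closed walk in the complete graph: the sum of the labels
of its edges. -/
def circleMultisign (σ : Multisigning V m) {v : V} (c : (⊤ : SimpleGraph V).Walk v v) :
    Fin m → ZMod 2 :=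
  (c.edges.map σ).sum

/-- The multisign of the triangle with vertex set `t` (a set of three vertices): the sum of the
labels of the edges with both ends in `t`. -/
def triangleMultisign [DecidableEq V] (σ : Multisigning V m) (t : Finset V) : Fin m → ZMod 2 :=
  ∑ e ∈ t.sym2 with ¬ e.IsDiag, σ e

/-- `η(g)`, the number of triangles with multisign `g`. -/
def eta [Fintype V] [DecidableEq V] (σ : Multisigning V m) (g : Fin m → ZMod 2) : ℕ :=
  {t ∈ Finset.powersetCard 3 (Finset.univ : Finset V) | σ.triangleMultisign t = g}.card

/-- `𝒮(Σ)`, the set of multisigns of Hamiltonian circles. -/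
def hamiltonianMultisigns [DecidableEq V] (σ : Multisigning V m) : Set (Fin m → ZMod 2) :=
  {g | ∃ (v : V) (c : (⊤ : SimpleGraph V).Walk v v),
    c.IsHamiltonianCycle ∧ σ.circleMultisign c = g}

end Multisigning

/-! In coordinates for the basis `x`, every triangle is labelled by a unit vector, that is, by a
color. Necessity: a functional that is constant on triangles is determined on a closed walk by the
length (`walk_sum_eq`). The coordinate of an absent color is 0 on every triangle and the coordinate
sum is 1 on every triangle, so a Hamiltonian multisign is supported on the occurring colors and has
coordinate sum `n` mod 2. These vectors form `U'` or `x₁ + U'` (`mem_span_differences_iff`).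

Sufficiency: inserting `z` into an edge of a circle adds the label of the triangle on `z` and that
edge, and for fixed `z` the triangles over all edges of the circle sum to the circle's label
(`sum_tri`). So any new vertex can be inserted so as to turn a chosen coordinate 1 into 0, and it is
enough to realize the all-ones vector on the occurring colors (`exists_ones_bound`). For this, a few
vertices `W` carry all colors, and Ramsey's theorem gives a large `Q` whose triangles share one
color. Starting from `Q`, a vertex of `W` that brings a new color brings only one, and every circle
has an edge where inserting it adds that color (`exists_edge_of_new_color`). All other vertices are
inserted in pairs whose contributions cancel (`HasCycleSum.add_pair`). -/

namespace Multisigning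

set_option linter.unusedSectionVars false

/-! ### Cyclic orders and the insertion of a vertex. -/

section Cycles

variable {V ι : Type*} [DecidableEq V]

/-- `f` permutes the vertices of `X` in a single cycle and fixes all other vertices. -/
def IsCyclicOrder (X : Finset V) (f : Equiv.Perm V) : Prop :=
  ∃ l : List V, l.Nodup ∧ l.toFinset = X ∧ l.formPerm = f

theorem IsCyclicOrder.isCycleOn {X : Finset V} {f : Equiv.Perm V} (h : IsCyclicOrder X f) :
    f.IsCycleOn X := by
  obtain ⟨l, hl, rfl, rfl⟩ := h
  simpa using hl.isCycleOn_formPerm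

theorem IsCyclicOrder.mem {X : Finset V} {f : Equiv.Perm V} (h : IsCyclicOrder X f) {u : V}
    (hu : u ∈ X) : f u ∈ X := by
  simpa using h.isCycleOn.1.mapsTo hu

theorem IsCyclicOrder.ne {X : Finset V} {f : Equiv.Perm V} (h : IsCyclicOrder X f)
    (hX : 2 ≤ X.card) {u : V} (hu : u ∈ X) : f u ≠ u := by
  apply h.isCycleOn.apply_ne ?_ hu
  exact_mod_cast Finset.one_lt_card_iff_nontrivial.1 hX

theorem IsCyclicOrder.sum_comp {M : Type*} [AddCommMonoid M] {X : Finset V} {f : Equiv.Perm V}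
    (h : IsCyclicOrder X f) (a : V → M) : ∑ u ∈ X, a (f u) = ∑ u ∈ X, a u := by
  have hb := h.isCycleOn.1
  refine Finset.sum_bij (fun u _ => f u) (fun u hu => h.mem hu) (fun _ _ _ _ e => f.injective e)
    (fun w hw => ?_) (fun _ _ => rfl)
  obtain ⟨u, hu, e⟩ := hb.surjOn hw
  exact ⟨u, by simpa using hu, e⟩

/-- A set of vertices closed under a cyclic order of `X` and meeting `X` contains `X`. -/
theorem IsCyclicOrder.induction {X : Finset V} {f : Equiv.Perm V} (h : IsCyclicOrder X f)
    {P : V → Prop} {u : V} (hu : u ∈ X) (h0 : P u) (hs : ∀ v ∈ X, P v → P (f v)) {w : V}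
    (hw : w ∈ X) : P w := by
  obtain ⟨n, -, rfl⟩ := h.isCycleOn.exists_pow_eq hu hw
  have : ∀ n : ℕ, (f ^ n) u ∈ X ∧ P ((f ^ n) u) := by
    intro n
    induction n with
    | zero => exact ⟨hu, h0⟩
    | succ n ih =>
      rw [pow_succ', Equiv.Perm.mul_apply]
      exact ⟨h.mem ih.1, hs _ ih.1 ih.2⟩
  exact (this n).2

/-- Insert a new vertex `z` into a cyclic order between `u` and its successor. -/
theorem IsCyclicOrder.insert {X : Finset V} {f : Equiv.Perm V} (h : IsCyclicOrder X f) {z u : V}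
    (hz : z ∉ X) (hu : u ∈ X) : ∃ f' : Equiv.Perm V, IsCyclicOrder (insert z X) f' ∧
      f' u = z ∧ f' z = f u ∧ ∀ v, v ≠ u → v ≠ z → f' v = f v := by
  have hfu := h.mem hu
  have hinj := f.injective
  obtain ⟨l, hl, rfl, rfl⟩ := h
  obtain ⟨a, b, hab⟩ := List.append_of_mem (List.mem_toFinset.1 hfu)
  set f := l.formPerm with hf
  set y := f u with hy
  -- Rotated to start at the successor `y` of `u`, the list ends at `u`, so a `z` put in front lands
  -- between them.
  have hrot : l ~r y :: (b ++ a) := ⟨a.length, by rw [hab]; simp⟩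
  have hl' : (y :: (b ++ a)).Nodup := hrot.nodup_iff.1 hl
  have hform : (y :: (b ++ a)).formPerm = f := (List.formPerm_eq_of_isRotated hl hrot).symm
  have hmem : ∀ v, v ∈ y :: (b ++ a) ↔ v ∈ l := fun v => hrot.mem_iff.symm
  have hzl : z ∉ l := by simpa using hz
  have hz' : f z = z := List.formPerm_apply_of_notMem hzl
  have hval : ∀ v, (z :: y :: (b ++ a)).formPerm v = Equiv.swap z y (f v) := by
    intro v
    rw [List.formPerm_cons_cons, hform]; rfl
  refine ⟨(z :: y :: (b ++ a)).formPerm, ⟨_, ?_, ?_, rfl⟩, ?_, ?_, ?_⟩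
  · rw [List.nodup_cons]
    exact ⟨fun hc => hzl ((hmem z).1 hc), hl'⟩
  · ext v
    rw [List.mem_toFinset, List.mem_cons, hmem]; simp
  · rw [hval, ← hy, Equiv.swap_apply_right]
  · rw [hval, hz', Equiv.swap_apply_left]
  · intro v hvu hvz
    rw [hval, Equiv.swap_apply_of_ne_of_ne]
    · exact fun e => hvz (hinj (e.trans hz'.symm))
    · exact fun e => hvu (hinj e)

theorem IsCyclicOrder.sum_insert {M : Type*} [AddCommGroup M] {X : Finset V} {f f' : Equiv.Perm V}
    {z u : V} (hz : z ∉ X) (hu : u ∈ X) (h1 : f' u = z) (h2 : f' z = f u)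
    (h3 : ∀ v, v ≠ u → v ≠ z → f' v = f v) (s : V → V → M) :
    ∑ v ∈ Insert.insert z X, s v (f' v) =
      ∑ v ∈ X, s v (f v) + (s u z + s z (f u) - s u (f u)) := by
  rw [Finset.sum_insert hz, ← Finset.add_sum_erase X _ hu, ← Finset.add_sum_erase X _ hu, h1, h2]
  have : ∑ v ∈ X.erase u, s v (f' v) = ∑ v ∈ X.erase u, s v (f v) := by
    refine Finset.sum_congr rfl fun v hv => ?_
    rw [Finset.mem_erase] at hv
    rw [h3 v hv.1 (fun e => hz (e ▸ hv.2))]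
  rw [this]
  abel

end Cycles

/-! ### Triangle colors and how insertions change the label of a circle. -/

section Core

variable {V ι : Type*}

/-- The label of the triangle `u v w` under an edge labelling `s`. -/
def tri (s : V → V → ι → ZMod 2) (u v w : V) : ι → ZMod 2 := s u v + s v w + s w u

/-- A symmetric labelling, vanishing on the diagonal, with a unit vector on every triangle. -/
structure TriangleColored [DecidableEq ι] (s : V → V → ι → ZMod 2) : Prop where
  symm : ∀ u v, s u v = s v u
  self : ∀ u, s u u = 0
  unit : ∀ u v w, u ≠ v → v ≠ w → u ≠ w → ∃ i, tri s u v w = Pi.single i 1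

open Classical in
/-- The indices `i` whose unit vector is the label of a triangle in `X`. -/
noncomputable def colors [Fintype ι] (s : V → V → ι → ZMod 2) (X : Finset V) : Finset ι :=
  {i | ∃ u ∈ X, ∃ v ∈ X, ∃ w ∈ X, tri s u v w i = 1}

theorem mem_colors [Fintype ι] {s : V → V → ι → ZMod 2} {X : Finset V} {i : ι} :
    i ∈ colors s X ↔ ∃ u ∈ X, ∃ v ∈ X, ∃ w ∈ X, tri s u v w i = 1 := by
  simp [colors]

theorem colors_mono [Fintype ι] {s : V → V → ι → ZMod 2} {X Y : Finset V} (h : X ⊆ Y) :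
    colors s X ⊆ colors s Y := by
  intro i hi
  obtain ⟨u, hu, v, hv, w, hw, e⟩ := mem_colors.1 hi
  exact mem_colors.2 ⟨u, h hu, v, h hv, w, h hw, e⟩

theorem zmod_two_eq_zero_or_one (a : ZMod 2) : a = 0 ∨ a = 1 := by
  revert a; decide

theorem pi_add_self (a : ι → ZMod 2) : a + a = 0 := funext fun _ => CharTwo.add_self_eq_zero _

theorem tri_rotate (s : V → V → ι → ZMod 2) (u v w : V) : tri s u v w = tri s v w u := by
  unfold tri; abel

theorem tri_eq_zero_of_notMem_colors [Fintype ι] {s : V → V → ι → ZMod 2} {X : Finset V} {i : ι}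
    (h : i ∉ colors s X) {u v w : V} (hu : u ∈ X) (hv : v ∈ X) (hw : w ∈ X) :
    tri s u v w i = 0 :=
  (zmod_two_eq_zero_or_one _).resolve_right fun e => h (mem_colors.2 ⟨u, hu, v, hv, w, hw, e⟩)

variable [DecidableEq ι] {s : V → V → ι → ZMod 2}

/-- Each of the six edges of a tetrahedron lies in two of its triangles. -/
theorem tri_add_tri_add_tri (hs : TriangleColored s) (z u v w : V) :
    tri s z u v + tri s z v w + tri s z u w = tri s u v w := by
  unfold tri
  rw [hs.symm v z, hs.symm w z, hs.symm w u]
  have h := @pi_add_self ι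
  linear_combination h (s z u) + h (s z v) + h (s z w)

theorem tri_swap (hs : TriangleColored s) (u v w : V) : tri s u v w = tri s u w v := by
  unfold tri
  rw [hs.symm w u, hs.symm v w, hs.symm u v]
  abel

theorem tri_self (hs : TriangleColored s) (u v : V) : tri s u v v = 0 := by
  unfold tri
  rw [hs.symm v u, hs.self, add_zero, pi_add_self]

theorem TriangleColored.ne_of_tri (hs : TriangleColored s) {u v w : V} {i : ι}
    (h : tri s u v w i = 1) : u ≠ v ∧ v ≠ w ∧ u ≠ w := by
  refine ⟨?_, ?_, ?_⟩ <;> rintro rfl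
  · rw [tri_rotate, tri_swap hs, tri_rotate, tri_rotate, tri_self hs] at h; simp at h
  · rw [tri_self hs] at h; simp at h
  · rw [tri_rotate, tri_self hs] at h; simp at h

theorem TriangleColored.tri_eq_single (hs : TriangleColored s) {u v w : V} {i : ι}
    (h : tri s u v w i = 1) : tri s u v w = Pi.single i 1 := by
  obtain ⟨h1, h2, h3⟩ := hs.ne_of_tri h
  obtain ⟨j, hj⟩ := hs.unit u v w h1 h2 h3
  rw [hj] at h ⊢
  by_cases e : i = j
  · rw [e]
  · simp [e] at h

theorem TriangleColored.color_unique (hs : TriangleColored s) {u v w : V} {i j : ι}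
    (h : tri s u v w i = 1) (h' : tri s u v w j = 1) : i = j := by
  rw [hs.tri_eq_single h] at h'
  by_contra e
  simp [Ne.symm e] at h'

/-- Additivity says that the pairs of `X` forming a triangle of color `d` with `z` are the edges of
a cut of `X`. -/
theorem tri_add_of_new_color [Fintype ι] (hs : TriangleColored s) {X : Finset V} {d : ι}
    (hd : d ∉ colors s X) (z : V) {u v w : V} (hu : u ∈ X) (hv : v ∈ X) (hw : w ∈ X) :
    tri s z u w d = tri s z u v d + tri s z v w d := by
  have h := congrFun (tri_add_tri_add_tri hs z u v w) d
  rw [tri_eq_zero_of_notMem_colors hd hu hv hw] at h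
  simp only [Pi.add_apply] at h
  have h2 := CharTwo.add_self_eq_zero (tri s z u w d)
  linear_combination h2 - h

variable [DecidableEq V]

/-- Every spoke from `z` occurs in two consecutive triangles and cancels. -/
theorem sum_tri (hs : TriangleColored s) {X : Finset V} {f : Equiv.Perm V} (h : IsCyclicOrder X f)
    (z : V) : ∑ u ∈ X, tri s z u (f u) = ∑ u ∈ X, s u (f u) := by
  unfold tri
  rw [Finset.sum_add_distrib, Finset.sum_add_distrib]
  have : ∑ u ∈ X, s (f u) z = ∑ u ∈ X, s z u := by
    rw [h.sum_comp (fun u => s u z)]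
    exact Finset.sum_congr rfl fun u _ => hs.symm _ _
  rw [this, add_right_comm, pi_add_self, zero_add]

theorem exists_tri_of_sum (hs : TriangleColored s) {X : Finset V} {f : Equiv.Perm V}
    (h : IsCyclicOrder X f) (z : V) {i : ι} (hi : (∑ u ∈ X, s u (f u)) i = 1) :
    ∃ u ∈ X, tri s z u (f u) i = 1 := by
  by_contra! hc
  rw [← sum_tri hs h z, Finset.sum_apply, Finset.sum_eq_zero] at hi
  · simp at hi
  · exact fun u hu => (zmod_two_eq_zero_or_one _).resolve_right (hc u hu)

theorem sum_insert_eq (hs : TriangleColored s) {X : Finset V} {f f' : Equiv.Perm V}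
    {z u : V} (hz : z ∉ X) (hu : u ∈ X) (h1 : f' u = z) (h2 : f' z = f u)
    (h3 : ∀ v, v ≠ u → v ≠ z → f' v = f v) :
    ∑ v ∈ insert z X, s v (f' v) = ∑ v ∈ X, s v (f v) + tri s z u (f u) := by
  rw [IsCyclicOrder.sum_insert hz hu h1 h2 h3, tri, hs.symm u z, hs.symm (f u) z]
  linear_combination -pi_add_self (s u (f u))

/-- `X` has a Hamiltonian circle with label `g`. -/
def HasCycleSum (s : V → V → ι → ZMod 2) (X : Finset V) (g : ι → ZMod 2) : Prop :=
  ∃ f : Equiv.Perm V, IsCyclicOrder X f ∧ ∑ u ∈ X, s u (f u) = g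

theorem hasCycleSum_insert (hs : TriangleColored s) {X : Finset V} {f : Equiv.Perm V}
    (h : IsCyclicOrder X f) {z u : V} (hz : z ∉ X) (hu : u ∈ X) {i : ι}
    (hi : tri s z u (f u) i = 1) :
    HasCycleSum s (insert z X) (∑ u ∈ X, s u (f u) + Pi.single i 1) := by
  obtain ⟨f', h', h1, h2, h3⟩ := h.insert hz hu
  exact ⟨f', h', by rw [sum_insert_eq hs hz hu h1 h2 h3, hs.tri_eq_single hi]⟩

variable [Fintype ι]

/-- A new color comes from a triangle at the new vertex. -/
theorem exists_tri_of_new_color (hs : TriangleColored s) {X : Finset V} {z : V} {d : ι}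
    (hd : d ∈ colors s (insert z X)) (hd' : d ∉ colors s X) :
    ∃ u ∈ X, ∃ v ∈ X, tri s z u v d = 1 := by
  obtain ⟨u, hu, v, hv, w, hw, e⟩ := mem_colors.1 hd
  obtain ⟨h1, h2, h3⟩ := hs.ne_of_tri e
  rw [Finset.mem_insert] at hu hv hw
  rcases hu with rfl | hu
  · exact ⟨v, hv.resolve_left h1.symm, w, hw.resolve_left h3.symm, e⟩
  rcases hv with rfl | hv
  · exact ⟨w, hw.resolve_left h2.symm, u, hu, by rw [← tri_rotate]; exact e⟩
  rcases hw with rfl | hw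
  · exact ⟨u, hu, v, hv, by rw [tri_rotate]; exact e⟩
  · exact absurd (mem_colors.2 ⟨u, hu, v, hv, w, hw, e⟩) hd'

/-- Adding a vertex brings at most one new color. -/
theorem new_color_unique (hs : TriangleColored s) {X : Finset V} {z : V} {d d' : ι}
    (hd : d ∈ colors s (insert z X)) (hd0 : d ∉ colors s X)
    (he : d' ∈ colors s (insert z X)) (he0 : d' ∉ colors s X) : d = d' := by
  by_contra hne
  obtain ⟨u, hu, v, hv, e⟩ := exists_tri_of_new_color hs hd hd0
  obtain ⟨u', hu', v', hv', e'⟩ := exists_tri_of_new_color hs he he0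
  have excl : ∀ a b, tri s z a b d = 1 → tri s z a b d' = 0 := fun a b h =>
    (zmod_two_eq_zero_or_one _).resolve_right fun h' => hne (hs.color_unique h h')
  -- Two nonempty cuts of a complete graph share an edge. Here the `d`-cut separates `w` from `u` or
  -- from `v`, and that edge is then outside the `d'`-cut. As `u` and `v` are on one side of the
  -- `d'`-cut, so is every `w`.
  have key : ∀ w ∈ X, tri s z u w d' = 0 := by
    intro w hw
    have h1 := tri_add_of_new_color hs hd0 z hu hv hw
    have h2 := tri_add_of_new_color hs he0 z hu hv hw
    rw [excl u v e, zero_add] at h2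
    rcases zmod_two_eq_zero_or_one (tri s z u w d) with h | h
    · rw [h2]
      apply excl
      rw [h, e] at h1
      exact ((zmod_two_eq_zero_or_one _).resolve_left fun h0 => by rw [h0] at h1; simp at h1)
    · exact excl _ _ h
  have h3 := tri_add_of_new_color hs he0 z hu hu' hv'
  rw [key _ hv', key _ hu', e'] at h3
  simp at h3

/-- A cyclic order on `X` has an edge forming a triangle of the new color with `z`. -/
theorem exists_edge_of_new_color (hs : TriangleColored s) {X : Finset V} {f : Equiv.Perm V}
    (h : IsCyclicOrder X f) {z : V} {d : ι}
    (hd : d ∈ colors s (insert z X)) (hd0 : d ∉ colors s X) :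
    ∃ u ∈ X, tri s z u (f u) d = 1 := by
  by_contra! hc
  obtain ⟨u, hu, v, hv, e⟩ := exists_tri_of_new_color hs hd hd0
  have : tri s z u v d = 0 := by
    -- If no edge of the circle crosses the cut, all of `X` lies on the side of `u`.
    refine h.induction (P := fun w => tri s z u w d = 0) hu (by rw [tri_self hs]; rfl) ?_ hv
    intro w hw hw0
    rw [tri_add_of_new_color hs hd0 z hu hw (h.mem hw), hw0, zero_add]
    exact (zmod_two_eq_zero_or_one _).resolve_right (hc w hw)
  rw [this] at e
  simp at e

end Core

/-! ### Monochromatic cliques. -/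

section Ramsey

/-- Multicolor Ramsey theorem, stated with one clique size for each color. -/
theorem exists_monochromatic_clique {ι : Type*} [Fintype ι] [DecidableEq ι] [Nonempty ι]
    (k : ℕ) : ∀ r : ι → ℕ, ∑ i, r i = k → ∃ N : ℕ, ∀ {V : Type} [DecidableEq V]
      (col : V → V → ι), (∀ u v, col u v = col v u) → ∀ A : Finset V, N ≤ A.card →
      ∃ i, ∃ Q ⊆ A, Q.card = r i ∧ ∀ u ∈ Q, ∀ v ∈ Q, u ≠ v → col u v = i := by
  induction k with
  | zero =>
    intro r hr
    obtain ⟨i⟩ := ‹Nonempty ι›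
    refine ⟨0, fun col _ A _ => ⟨i, ∅, by simp, ?_, by simp⟩⟩
    have := (Finset.sum_eq_zero_iff.1 hr) i (Finset.mem_univ i)
    simp [this]
  | succ k ih =>
    intro r hr
    by_cases h0 : ∃ i, r i = 0
    · obtain ⟨i, hi⟩ := h0
      exact ⟨0, fun col _ A _ => ⟨i, ∅, by simp, by simp [hi], by simp⟩⟩
    have hpos : ∀ i, 0 < r i := fun i => Nat.pos_of_ne_zero fun e => h0 ⟨i, e⟩
    have hdec : ∀ i, ∑ j, Function.update r i (r i - 1) j = k := by
      intro i
      rw [Finset.sum_update_of_mem (Finset.mem_univ i)]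
      have h1 := Finset.add_sum_erase Finset.univ r (Finset.mem_univ i)
      rw [← Finset.sdiff_singleton_eq_erase] at h1
      have := hpos i
      omega
    choose N hN using fun i => ih _ (hdec i)
    -- One vertex is spent on `v`; among the others some color class at `v` reaches its own bound `N
    -- i`.
    refine ⟨∑ i, N i + 1, fun {V} _ col hsymm A hA => ?_⟩
    obtain ⟨v, hv⟩ : A.Nonempty := Finset.card_pos.1 (by omega)
    obtain ⟨i, hi⟩ : ∃ i, N i ≤ ((A.erase v).filter fun u => col v u = i).card := by
      by_contra! hc
      have h1 := Finset.card_eq_sum_card_fiberwise (f := fun u => col v u) (s := A.erase v)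
        (t := Finset.univ) (fun _ _ => Finset.mem_coe.2 (Finset.mem_univ _))
      have h2 : ∑ i, ((A.erase v).filter fun u => col v u = i).card ≤ ∑ i, N i :=
        Finset.sum_le_sum fun i _ => (hc i).le
      obtain ⟨i0⟩ := ‹Nonempty ι›
      have h3 : ∑ i, ((A.erase v).filter fun u => col v u = i).card < ∑ i, N i :=
        Finset.sum_lt_sum_of_nonempty ⟨i0, Finset.mem_univ _⟩ fun i _ => hc i
      rw [Finset.card_erase_of_mem hv] at h1
      omega
    obtain ⟨j, Q, hQ, hcard, hcol⟩ := hN i col hsymm _ hi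
    have hQA : Q ⊆ A.erase v := hQ.trans (Finset.filter_subset _ _)
    by_cases hij : j = i
    · subst hij
      have hvQ : v ∉ Q := fun h => by simpa using hQA h
      refine ⟨j, insert v Q, ?_, ?_, ?_⟩
      · exact Finset.insert_subset hv (hQA.trans (Finset.erase_subset _ _))
      · rw [Finset.card_insert_of_notMem hvQ, hcard, Function.update_self]
        have := hpos j
        omega
      · have hv' : ∀ u ∈ Q, col v u = j := fun u hu => (Finset.mem_filter.1 (hQ hu)).2
        intro a ha b hb hab
        rw [Finset.mem_insert] at ha hb
        rcases ha with rfl | ha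
        · rcases hb with rfl | hb
          · exact absurd rfl hab
          · exact hv' b hb
        · rcases hb with rfl | hb
          · rw [hsymm]; exact hv' a ha
          · exact hcol a ha b hb hab
    · refine ⟨j, Q, hQA.trans (Finset.erase_subset _ _), ?_, hcol⟩
      rw [hcard, Function.update_of_ne hij]

end Ramsey

/-! ### Circles whose label is the all-ones vector on the occurring colors. -/

section Rainbow

variable {V ι : Type*} [DecidableEq V] [DecidableEq ι] [Fintype ι] {s : V → V → ι → ZMod 2}

/-- The indicator vector of a set of colors. -/
def ones (C : Finset ι) : ι → ZMod 2 := fun i => if i ∈ C then 1 else 0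

/-- By pigeonhole two edges of the circle form triangles of the same color with `z`. That color has
coordinate 1 in the label, so some edge also forms such a triangle with `y`. Inserting both vertices
adds the color twice. -/
theorem HasCycleSum.add_pair (hs : TriangleColored s) {X : Finset V} {z y : V}
    (h : HasCycleSum s X (ones (colors s X))) (hz : z ∉ X) (hy : y ∉ insert z X)
    (hcol : colors s (insert y (insert z X)) = colors s X) (h2 : 2 ≤ X.card)
    (hcard : (colors s X).card < X.card) :
    HasCycleSum s (insert y (insert z X)) (ones (colors s X)) := by
  obtain ⟨f, hf, hsum⟩ := h
  have hex : ∀ u, u ∈ X → ∃ i, tri s z u (f u) i = 1 := by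
    intro u hu
    obtain ⟨i, hi⟩ := hs.unit z u (f u) (fun e => hz (e ▸ hu)) (hf.ne h2 hu).symm
      (fun e => hz (e ▸ hf.mem hu))
    exact ⟨i, by rw [hi]; simp⟩
  obtain ⟨v, hv⟩ : X.Nonempty := Finset.card_pos.1 (by omega)
  have : Nonempty ι := ⟨(hex v hv).choose⟩
  choose! a ha using hex
  have hmaps : ∀ u ∈ X, a u ∈ colors s X := by
    intro u hu
    rw [← hcol]
    exact mem_colors.2 ⟨z, by simp, u, by simp [hu], f u, by simp [hf.mem hu], ha u hu⟩
  obtain ⟨u1, hu1, u2, hu2, hne, hau⟩ := Finset.exists_ne_map_eq_of_card_lt_of_maps_to hcard hmaps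
  obtain ⟨w, hw, hwy⟩ := exists_tri_of_sum hs hf y (i := a u1) (by
    rw [hsum, ones, if_pos (hmaps u1 hu1)])
  -- The edge at `w` must survive the insertion of `z`; having two candidate edges for `z` ensures
  -- this.
  obtain ⟨u, hu, hune, hua⟩ : ∃ u ∈ X, w ≠ u ∧ a u = a u1 := by
    by_cases e : w = u1
    · exact ⟨u2, hu2, fun h => hne (e.symm.trans h), hau.symm⟩
    · exact ⟨u1, hu1, e, rfl⟩
  obtain ⟨f', hf', e1, e2, e3⟩ := hf.insert hz hu
  have hw' : f' w = f w := e3 w hune (fun e => hz (e ▸ hw))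
  have := hasCycleSum_insert hs hf' hy (Finset.mem_insert_of_mem hw) (i := a u1) (by rwa [hw'])
  rw [sum_insert_eq hs hz hu e1 e2 e3, hsum, hs.tri_eq_single (ha u hu), hua, add_assoc,
    pi_add_self, add_zero] at this
  exact this

theorem HasCycleSum.extend (hs : TriangleColored s) {X Y : Finset V} (hXY : X ⊆ Y)
    (h : HasCycleSum s X (ones (colors s X))) (hcol : colors s Y = colors s X)
    (h2 : 2 ≤ X.card) (hcard : (colors s X).card < X.card)
    (hpar : (X.card : ZMod 2) = Y.card) : HasCycleSum s Y (ones (colors s Y)) := by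
  obtain ⟨n, hn⟩ : ∃ n, (Y \ X).card = n := ⟨_, rfl⟩
  induction n using Nat.strong_induction_on generalizing X with
  | _ n ih =>
    have hc := Finset.card_sdiff_add_card_eq_card hXY
    by_cases h0 : n = 0
    · have : Y \ X = ∅ := Finset.card_eq_zero.1 (hn.trans h0)
      rw [Finset.sdiff_eq_empty_iff_subset] at this
      rw [this.antisymm hXY]; exact h
    have h1 : n ≠ 1 := by
      rintro rfl
      rw [hn] at hc
      rw [← hc] at hpar
      push_cast at hpar
      simp at hpar
    obtain ⟨z, hz, y, hy, hzy⟩ := Finset.one_lt_card.1 (show 1 < (Y \ X).card by omega)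
    rw [Finset.mem_sdiff] at hz hy
    have hsub : insert y (insert z X) ⊆ Y :=
      Finset.insert_subset hy.1 (Finset.insert_subset hz.1 hXY)
    have hXs : X ⊆ insert y (insert z X) :=
      (Finset.subset_insert z X).trans (Finset.subset_insert y _)
    have hcol' : colors s (insert y (insert z X)) = colors s X :=
      ((colors_mono hsub).trans hcol.subset).antisymm (colors_mono hXs)
    have hy' : y ∉ insert z X := by simp [hy.2, hzy.symm]
    have hcd : (insert y (insert z X)).card = X.card + 2 := by
      rw [Finset.card_insert_of_notMem hy', Finset.card_insert_of_notMem hz.2]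
    have hcs := Finset.card_sdiff_add_card_eq_card hsub
    refine ih (Y \ insert y (insert z X)).card (by omega) hsub ?_ (by rw [hcol', hcol])
      (by omega) (by rw [hcol']; omega) ?_ rfl
    · rw [hcol']
      exact h.add_pair hs hz.2 hy' hcol' h2 hcard
    · rw [hcd, ← hpar]
      push_cast
      rw [show (2 : ZMod 2) = 0 from rfl, add_zero]

/-- A small set of vertices carrying all colors. -/
theorem exists_subset_colors (X : Finset V) :
    ∃ W ⊆ X, W.card ≤ 3 * (colors s X).card ∧ colors s W = colors s X := by
  have : ∀ i, i ∈ colors s X → ∃ T ⊆ X, T.card ≤ 3 ∧ i ∈ colors s T := by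
    intro i hi
    obtain ⟨u, hu, v, hv, w, hw, e⟩ := mem_colors.1 hi
    refine ⟨{u, v, w}, ?_, Finset.card_le_three, mem_colors.2 ⟨u, by simp, v, by simp, w, by simp, e⟩⟩
    intro a ha
    simp only [Finset.mem_insert, Finset.mem_singleton] at ha
    rcases ha with rfl | rfl | rfl <;> assumption
  choose! T hT hT3 hTi using this
  have hsub : (colors s X).biUnion T ⊆ X := Finset.biUnion_subset.2 hT
  refine ⟨(colors s X).biUnion T, hsub, ?_, (colors_mono hsub).antisymm fun i hi => ?_⟩
  · rw [mul_comm]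
    exact Finset.card_biUnion_le_card_mul _ _ _ hT3
  · exact colors_mono (Finset.subset_biUnion_of_mem T hi) (hTi i hi)

/-- At most three vertices per color suffice to carry all colors, so `Q` contains a vertex that can
be spared. -/
theorem exists_erase_colors_eq (X : Finset V) {Q : Finset V}
    (hcard : 3 * Fintype.card ι < Q.card) : ∃ q ∈ Q, colors s (X.erase q) = colors s X := by
  obtain ⟨W, hW, hWc, hWe⟩ := exists_subset_colors (s := s) X
  have := Finset.card_le_univ (colors s X)
  obtain ⟨q, hq, hqW⟩ := Finset.exists_mem_notMem_of_card_lt_card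
    (show W.card < Q.card by omega)
  refine ⟨q, hq, (colors_mono (Finset.erase_subset _ _)).antisymm ?_⟩
  rw [← hWe]
  exact colors_mono (Finset.subset_erase.2 ⟨hW, hqW⟩)

theorem colors_eq_singleton {Q : Finset V} {c : ι} (hs : TriangleColored s) (h3 : 3 ≤ Q.card)
    (hQ : ∀ u ∈ Q, ∀ v ∈ Q, ∀ w ∈ Q, u ≠ v → v ≠ w → u ≠ w → tri s u v w c = 1) :
    colors s Q = {c} := by
  ext i
  rw [Finset.mem_singleton, mem_colors]
  constructor
  · rintro ⟨u, hu, v, hv, w, hw, e⟩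
    obtain ⟨h1, h2, h3⟩ := hs.ne_of_tri e
    exact hs.color_unique e (hQ u hu v hv w hw h1 h2 h3)
  · rintro rfl
    obtain ⟨u, v, w, hu, hv, hw, h1, h2, h3⟩ := Finset.two_lt_card_iff.1 h3
    exact ⟨u, hu, v, hv, w, hw, hQ u hu v hv w hw h1 h3 h2⟩

theorem hasCycleSum_triangle {u v w : V} (h1 : u ≠ v) (h2 : v ≠ w) (h3 : u ≠ w) :
    HasCycleSum s {u, v, w} (tri s u v w) := by
  have hn : [u, v, w].Nodup := by simp [h1, h2, h3]
  refine ⟨[u, v, w].formPerm, ⟨_, hn, by simp, rfl⟩, ?_⟩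
  rw [Finset.sum_insert (by simp [h1, h3]), Finset.sum_insert (by simp [h2]),
    Finset.sum_singleton]
  have e1 : [u, v, w].formPerm u = v := by
    simpa using List.formPerm_apply_getElem [u, v, w] hn 0 (by simp)
  have e2 : [u, v, w].formPerm v = w := by
    simpa using List.formPerm_apply_getElem [u, v, w] hn 1 (by simp)
  have e3 : [u, v, w].formPerm w = u := by
    simp
  rw [e1, e2, e3, tri, add_assoc]

theorem hasCycleSum_monochromatic (hs : TriangleColored s) {Q : Finset V} {c : ι}
    (h3 : 3 ≤ Q.card) (hpar : (Q.card : ZMod 2) = 1)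
    (hQ : ∀ u ∈ Q, ∀ v ∈ Q, ∀ w ∈ Q, u ≠ v → v ≠ w → u ≠ w → tri s u v w c = 1) :
    HasCycleSum s Q (ones (colors s Q)) := by
  obtain ⟨u, v, w, hu, hv, hw, h1, h2, h3'⟩ := Finset.two_lt_card_iff.1 h3
  have hsub : ({u, v, w} : Finset V) ⊆ Q := by
    intro a ha
    simp only [Finset.mem_insert, Finset.mem_singleton] at ha
    rcases ha with rfl | rfl | rfl <;> assumption
  have hc : ({u, v, w} : Finset V).card = 3 := Finset.card_eq_three.2 ⟨u, v, w, h1, h2, h3', rfl⟩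
  have hcT : colors s {u, v, w} = {c} := colors_eq_singleton hs hc.ge
    fun a ha b hb d hd => hQ a (hsub ha) b (hsub hb) d (hsub hd)
  refine HasCycleSum.extend hs hsub ?_ (by rw [hcT, colors_eq_singleton hs h3 hQ])
    (by omega) (by rw [hcT, hc]; simp) (by rw [hpar, hc]; rfl)
  have := hasCycleSum_triangle (s := s) h1 h3' h2
  rw [hs.tri_eq_single (hQ u hu v hv w hw h1 h3' h2)] at this
  rw [hcT]
  convert this using 1
  ext i
  simp [ones, Pi.single_apply]

theorem ones_insert {C : Finset ι} {d : ι} (h : d ∉ C) :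
    ones (insert d C) = ones C + Pi.single d 1 := by
  ext i
  by_cases e : i = d
  · subst e; simp [ones, h]
  · simp [ones, e]

/-- The parity hypothesis is necessary: the coordinate sum of the label is the number of colors. The
size bound on `Q` leaves one vertex to be given up for each vertex of `W`. -/
theorem hasCycleSum_union (hs : TriangleColored s) {c : ι} (W : Finset V) :
    ∀ Q : Finset V, Disjoint W Q →
      (∀ u ∈ Q, ∀ v ∈ Q, ∀ w ∈ Q, u ≠ v → v ≠ w → u ≠ w → tri s u v w c = 1) →
      3 * Fintype.card ι + 3 + W.card ≤ Q.card →
      ((W ∪ Q).card : ZMod 2) = (colors s (W ∪ Q)).card →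
      HasCycleSum s (W ∪ Q) (ones (colors s (W ∪ Q))) := by
  induction W using Finset.induction_on with
  | empty =>
    intro Q _ hQ hcard hpar
    rw [Finset.empty_union] at hpar ⊢
    refine hasCycleSum_monochromatic hs (by omega) ?_ hQ
    rw [hpar, colors_eq_singleton hs (by omega) hQ]
    simp
  | insert z W hzW ih =>
    intro Q hdisj hQ hcard hpar
    rw [Finset.disjoint_insert_left] at hdisj
    rw [Finset.card_insert_of_notMem hzW] at hcard
    rw [Finset.insert_union] at hpar ⊢
    have hz : z ∉ W ∪ Q := by simp [hzW, hdisj.1]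
    rw [Finset.card_insert_of_notMem hz] at hpar
    by_cases hcrit : colors s (insert z (W ∪ Q)) = colors s (W ∪ Q)
    · obtain ⟨q, hq, hqe⟩ := exists_erase_colors_eq (s := s) (W ∪ Q) (Q := Q) (by omega)
      have hqW : q ∉ W := fun h => Finset.disjoint_left.1 hdisj.2 h hq
      have hwq : W ∪ Q.erase q = (W ∪ Q).erase q := by
        rw [Finset.erase_union_distrib, Finset.erase_eq_of_notMem hqW]
      have hqc := Finset.card_erase_of_mem hq
      have hqu : q ∈ W ∪ Q := Finset.mem_union_right _ hq
      have hins : insert q ((W ∪ Q).erase q) = W ∪ Q := Finset.insert_erase hqu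
      have hcu := Finset.card_erase_add_one hqu
      have hQu : Q.card ≤ (W ∪ Q).card := Finset.card_le_card Finset.subset_union_right
      have hι := Finset.card_le_univ (colors s (W ∪ Q))
      have key := ih (Q.erase q) (hdisj.2.mono_right (Finset.erase_subset _ _))
        (fun u hu v hv w hw => hQ u (Finset.mem_of_mem_erase hu) v (Finset.mem_of_mem_erase hv) w
          (Finset.mem_of_mem_erase hw)) (by omega) (by
          rw [hwq, hqe, ← hcrit, ← hpar, ← hcu]
          push_cast
          rw [add_assoc, show (1 : ZMod 2) + 1 = 0 from rfl, add_zero])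
      rw [hwq] at key
      refine key.extend hs ((Finset.erase_subset _ _).trans (Finset.subset_insert _ _))
        (hcrit.trans hqe.symm) (by omega) (by rw [hqe]; omega) ?_
      rw [Finset.card_insert_of_notMem hz, ← hcu]
      push_cast
      rw [add_assoc, show (1 : ZMod 2) + 1 = 0 from rfl, add_zero]
    -- Both the vertex count and the color count grow by one here, so the parity condition passes to
    -- `W ∪ Q`.
    · have hss : colors s (W ∪ Q) ⊂ colors s (insert z (W ∪ Q)) :=
        (colors_mono (Finset.subset_insert _ _)).ssubset_of_ne (Ne.symm hcrit)
      obtain ⟨d, hd, hd0⟩ := Finset.exists_of_ssubset hss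
      have hins : colors s (insert z (W ∪ Q)) = insert d (colors s (W ∪ Q)) := by
        ext i
        rw [Finset.mem_insert]
        constructor
        · intro hi
          by_cases hi0 : i ∈ colors s (W ∪ Q)
          · exact Or.inr hi0
          · exact Or.inl (new_color_unique hs hi hi0 hd hd0)
        · rintro (rfl | hi)
          · exact hd
          · exact hss.subset hi
      rw [hins, Finset.card_insert_of_notMem hd0] at hpar
      push_cast at hpar
      obtain ⟨f, hf, hsum⟩ := ih Q hdisj.2 hQ (by omega) (add_right_cancel hpar)
      obtain ⟨u, hu, hud⟩ := exists_edge_of_new_color hs hf hd hd0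
      have := hasCycleSum_insert hs hf hz hu hud
      rw [hsum, ← ones_insert hd0] at this
      rwa [hins]

end Rainbow

/-! ### All admissible labels are realized. -/

section Full

variable {ι : Type*} [DecidableEq ι] [Fintype ι]

theorem exists_ones_bound [Nonempty ι] : ∃ N : ℕ, ∀ {V : Type} [DecidableEq V]
    {s : V → V → ι → ZMod 2}, TriangleColored s → ∀ X : Finset V, N ≤ X.card →
    (X.card : ZMod 2) = (colors s X).card → HasCycleSum s X (ones (colors s X)) := by
  -- `hasCycleSum_union` asks for `3 * Fintype.card ι + 3 + W.card` vertices with `W.card ≤ 3 *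
  -- Fintype.card ι`; one more is kept for the parity.
  obtain ⟨N, hN⟩ := exists_monochromatic_clique (ι := ι) _
    (fun _ => 6 * Fintype.card ι + 4) rfl
  refine ⟨N + 3 * Fintype.card ι + 1, fun {V} _ {s} hs X hX hpar => ?_⟩
  obtain ⟨W, hW, hWc, hWe⟩ := exists_subset_colors (s := s) X
  have hι := Finset.card_le_univ (colors s X)
  have hXW := Finset.card_sdiff_add_card_eq_card hW
  obtain ⟨z, hz⟩ : (X \ W).Nonempty := Finset.card_pos.1 (by omega)
  classical
  -- A pair is colored by its triangle with `z`; the default value only concerns degenerate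
  -- triangles.
  let col : V → V → ι := fun u v =>
    if h : ∃ i, tri s z u v i = 1 then h.choose else Classical.arbitrary ι
  have hcol : ∀ {u v i}, tri s z u v i = 1 → col u v = i := by
    intro u v i h
    have hex : ∃ i, tri s z u v i = 1 := ⟨i, h⟩
    simp only [col, dif_pos hex]
    exact hs.color_unique hex.choose_spec h
  obtain ⟨c, Q, hQ, hQc, hmono⟩ := hN col (fun u v => by simp only [col, tri_swap hs z u v])
    ((X \ W).erase z) (by rw [Finset.card_erase_of_mem hz]; omega)
  have hzQ : z ∉ Q := fun h => by simpa using hQ h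
  have htri : ∀ u ∈ Q, ∀ v ∈ Q, u ≠ v → tri s z u v c = 1 := by
    intro u hu v hv huv
    obtain ⟨i, hi⟩ := hs.unit z u v (fun e => hzQ (e ▸ hu)) huv (fun e => hzQ (e ▸ hv))
    have hi1 : tri s z u v i = 1 := by rw [hi]; simp
    rwa [← hmono u hu v hv huv, hcol hi1]
  -- A triangle in `Q` is the sum of its three triangles with `z`, and 1 + 1 + 1 = 1 mod 2.
  have hQ3 : ∀ u ∈ Q, ∀ v ∈ Q, ∀ w ∈ Q, u ≠ v → v ≠ w → u ≠ w → tri s u v w c = 1 := by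
    intro u hu v hv w hw h1 h2 h3
    rw [← tri_add_tri_add_tri hs z u v w, Pi.add_apply, Pi.add_apply, htri u hu v hv h1,
      htri v hv w hw h2, htri u hu w hw h3]
    rfl
  have hQX : Q ⊆ X \ W := hQ.trans (Finset.erase_subset _ _)
  have main : ∀ Q' ⊆ Q, 3 * Fintype.card ι + 3 + W.card ≤ Q'.card →
      ((W ∪ Q').card : ZMod 2) = X.card → HasCycleSum s X (ones (colors s X)) := by
    intro Q' hQ' hcard hpar'
    have hsub : W ∪ Q' ⊆ X :=
      Finset.union_subset hW (hQ'.trans (hQX.trans Finset.sdiff_subset))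
    have hce : colors s (W ∪ Q') = colors s X := (colors_mono hsub).antisymm
      (hWe.symm.subset.trans (colors_mono Finset.subset_union_left))
    have hQu : Q'.card ≤ (W ∪ Q').card := Finset.card_le_card Finset.subset_union_right
    refine HasCycleSum.extend hs hsub (hasCycleSum_union hs (c := c) W Q' ?_ ?_ hcard ?_) hce.symm
      (by omega) (by rw [hce]; omega) hpar'
    · exact (Finset.disjoint_sdiff (s := W) (t := X)).mono_right (hQ'.trans hQX)
    · exact fun u hu v hv w hw => hQ3 u (hQ' hu) v (hQ' hv) w (hQ' hw)
    · rw [hce, hpar', hpar]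
  by_cases hp : ((W ∪ Q).card : ZMod 2) = X.card
  · exact main Q subset_rfl (by omega) hp
  · obtain ⟨q, hq⟩ : Q.Nonempty := Finset.card_pos.1 (by omega)
    refine main (Q.erase q) (Finset.erase_subset _ _)
      (by rw [Finset.card_erase_of_mem hq]; omega) ?_
    have hqW : q ∉ W := (Finset.mem_sdiff.1 (hQX hq)).2
    have hwq : W ∪ Q.erase q = (W ∪ Q).erase q := by
      rw [Finset.erase_union_distrib, Finset.erase_eq_of_notMem hqW]
    have hcu := Finset.card_erase_add_one (Finset.mem_union_right W hq)
    rw [hwq]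
    rw [← hcu] at hp
    push_cast at hp
    generalize (((W ∪ Q).erase q).card : ZMod 2) = a at hp ⊢
    generalize (X.card : ZMod 2) = b at hp ⊢
    revert a b
    decide

theorem exists_cycleSum_bound [Nonempty ι] : ∃ N : ℕ, ∀ {V : Type} [DecidableEq V]
    {s : V → V → ι → ZMod 2}, TriangleColored s → ∀ (X : Finset V) (g : ι → ZMod 2),
    N ≤ X.card → (∀ i, g i = 1 → i ∈ colors s X) → ∑ i, g i = X.card → HasCycleSum s X g := by
  obtain ⟨N, hN⟩ := exists_ones_bound (ι := ι)
  refine ⟨N + 4 * Fintype.card ι + 1, fun {V} _ {s} hs X g hX hg hpar => ?_⟩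
  -- Induction on the number `k` of occurring colors with coordinate 0. A vertex `z` is removed
  -- without losing a color, one such coordinate `c` is raised to 1, and reinserting `z` at a
  -- triangle of color `c` lowers it again. The summand `k` in the bound pays for the removed
  -- vertices.
  have key : ∀ (k : ℕ) (X : Finset V) (g : ι → ZMod 2), N + 3 * Fintype.card ι + 1 + k ≤ X.card →
      (∀ i, g i = 1 → i ∈ colors s X) → ∑ i, g i = X.card →
      ((colors s X).filter fun i => g i = 0).card = k → HasCycleSum s X g := by
    intro k
    induction k with
    | zero =>
      intro X g hX hg hpar hk
      have hg1 : g = ones (colors s X) := by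
        ext i
        rw [Finset.card_eq_zero, Finset.filter_eq_empty_iff] at hk
        by_cases hi : i ∈ colors s X
        · rw [ones, if_pos hi]
          exact (zmod_two_eq_zero_or_one _).resolve_left (hk hi)
        · rw [ones, if_neg hi]
          exact (zmod_two_eq_zero_or_one _).resolve_right fun h => hi (hg i h)
      rw [hg1]
      refine hN hs X (by omega) ?_
      rw [← hpar, hg1]
      simp [ones]
    | succ k ih =>
      intro X g hX hg hpar hk
      obtain ⟨z, hz, hze⟩ := exists_erase_colors_eq (s := s) X (Q := X) (by omega)
      obtain ⟨c, hc⟩ := Finset.card_pos.1 (show 0 < _ by rw [hk]; omega)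
      rw [Finset.mem_filter] at hc
      have hcu := Finset.card_erase_add_one hz
      have hgc : ∀ i, i ≠ c → (g + Pi.single c 1 : ι → ZMod 2) i = g i := fun i hi => by simp [hi]
      have hcc : (g + Pi.single c 1 : ι → ZMod 2) c = 1 := by simp [hc.2]
      have hmem : ∀ i, (g + Pi.single c 1 : ι → ZMod 2) i = 1 → i ∈ colors s (X.erase z) := by
        intro i hi
        rw [hze]
        by_cases e : i = c
        · exact e ▸ hc.1
        · exact hg i (by rwa [hgc i e] at hi)
      have hsum' : ∑ i, (g + Pi.single c 1 : ι → ZMod 2) i = (X.erase z).card := by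
        have : ∑ i, (g + Pi.single c 1 : ι → ZMod 2) i = ∑ i, g i + 1 := by
          simp [Finset.sum_add_distrib]
        rw [this, hpar, ← hcu]
        push_cast
        rw [add_assoc, show (1 : ZMod 2) + 1 = 0 from rfl, add_zero]
      have hcount : ((colors s (X.erase z)).filter
          fun i => (g + Pi.single c 1 : ι → ZMod 2) i = 0).card = k := by
        rw [hze]
        have : ((colors s X).filter fun i => (g + Pi.single c 1 : ι → ZMod 2) i = 0) =
            ((colors s X).filter fun i => g i = 0).erase c := by
          ext i
          rw [Finset.mem_erase, Finset.mem_filter, Finset.mem_filter]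
          by_cases e : i = c
          · subst e; rw [hcc]; simp
          · rw [hgc i e]; simp [e]
        rw [this, Finset.card_erase_of_mem (Finset.mem_filter.2 hc), hk]
        rfl
      obtain ⟨f, hf, hsum⟩ := ih (X.erase z) (g + Pi.single c 1) (by omega) hmem hsum' hcount
      obtain ⟨u, hu, hud⟩ := exists_tri_of_sum hs hf z (i := c) (by rw [hsum, hcc])
      have := hasCycleSum_insert hs hf (Finset.notMem_erase z X) hu hud
      rwa [hsum, Finset.insert_erase hz, add_assoc, pi_add_self, add_zero] at this
  refine key _ X g ?_ hg hpar rfl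
  have := (Finset.card_le_card (Finset.filter_subset (fun i => g i = 0) (colors s X))).trans
    (Finset.card_le_univ _)
  omega

end Full

/-! ### From cyclic orders to Hamiltonian walks, and sums along walks. -/

section Walks

variable {V : Type*} [DecidableEq V]

theorem map_formPerm_eq_rotate {l : List V} (hl : l.Nodup) : l.map l.formPerm = l.rotate 1 := by
  refine List.ext_getElem (by simp) fun i h1 h2 => ?_
  rw [List.getElem_map, List.getElem_rotate, List.formPerm_apply_getElem _ hl]

theorem exists_hamiltonianCycle_of_isCyclicOrder [Fintype V] {M : Type*} [AddCommMonoid M]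
    (σ : Sym2 V → M) {f : Equiv.Perm V} (h : IsCyclicOrder Finset.univ f)
    (h3 : 3 ≤ Fintype.card V) :
    ∃ (v : V) (c : (⊤ : SimpleGraph V).Walk v v), c.IsHamiltonianCycle ∧
      (c.edges.map σ).sum = ∑ u, σ s(u, f u) := by
  obtain ⟨l, hl, hlu, rfl⟩ := h
  have hlen : l.length = Fintype.card V := by
    rw [← List.toFinset_card_of_nodup hl, hlu, Finset.card_univ]
  obtain _ | ⟨v, l'⟩ := l
  · simp at hlen; omega
  have hchain : ((v :: l') ++ [v]).IsChain (⊤ : SimpleGraph V).Adj := by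
    rw [List.isChain_append]
    refine ⟨(hl.imp fun h => (SimpleGraph.top_adj _ _).2 h).isChain, by simp, ?_⟩
    intro x hx y hy
    simp only [List.head?_cons, Option.mem_def, Option.some.injEq] at hy
    subst hy
    rw [SimpleGraph.top_adj]
    rintro rfl
    obtain _ | ⟨a, l''⟩ := l'
    · simp at hlen; omega
    · rw [List.getLast?_cons_cons] at hx
      exact (List.nodup_cons.1 hl).1 (List.mem_of_getLast? hx)
  let c : (⊤ : SimpleGraph V).Walk v v :=
    (SimpleGraph.Walk.ofSupport ((v :: l') ++ [v]) (by simp) hchain).copy (by simp) (by simp)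
  have hsupp : c.support = (v :: l') ++ [v] := by
    exact (SimpleGraph.Walk.support_copy _ _ _).trans
      (SimpleGraph.Walk.support_ofSupport (by simp) hchain)
  have hclen : c.length = Fintype.card V := by
    have := c.length_support
    rw [hsupp] at this
    simp at this hlen
    omega
  refine ⟨v, c, ?_, ?_⟩
  · rw [SimpleGraph.Walk.isHamiltonianCycle_iff_isCycle_and_length_eq,
      SimpleGraph.Walk.isCycle_iff_isPath_tail_and_le_length]
    refine ⟨⟨?_, by omega⟩, hclen⟩
    have hnil : ¬ c.Nil := by
      rw [← SimpleGraph.Walk.length_eq_zero_iff]; omega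
    rw [SimpleGraph.Walk.isPath_def, SimpleGraph.Walk.support_tail_of_not_nil _ hnil, hsupp]
    have : (v :: l').rotate 1 = l' ++ [v] := by simp
    simpa [this] using (List.nodup_rotate (n := 1)).2 hl
  · rw [SimpleGraph.Walk.edges_eq_zipWith_support, hsupp]
    have hrot := map_formPerm_eq_rotate hl
    have e1 : (v :: l').rotate 1 = l' ++ [v] := by simp
    have e2 : ((v :: l') ++ [v]).tail = (v :: l').map (v :: l').formPerm := by
      rw [hrot, e1]; rfl
    have e3 : List.zipWith (s(·, ·)) ((v :: l') ++ [v]) ((v :: l') ++ [v]).tail =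
        (v :: l').map fun u => s(u, (v :: l').formPerm u) := by
      rw [e2, ← List.append_nil (List.map _ _), List.zipWith_append (by simp)]
      rw [List.zipWith_map_right, List.zipWith_self]
      simp
    rw [e3, List.map_map, ← hlu, List.sum_toFinset _ hl]
    rfl

/-- If a labelling takes the same value on all triangles, the sum of the labels along a walk is
determined by the length and the ends. -/
theorem walk_sum_eq (F : Sym2 V → ZMod 2) (ε : ZMod 2)
    (hF : ∀ u v w, u ≠ v → v ≠ w → u ≠ w → F s(u, v) + F s(v, w) + F s(u, w) = ε) {u v : V}
    (p : (⊤ : SimpleGraph V).Walk u v) :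
    (p.edges.map F).sum = p.length * ε + if u = v then 0 else F s(u, v) + ε := by
  induction p with
  | nil => simp
  | @cons u v w h p ih =>
    rw [SimpleGraph.top_adj] at h
    rw [SimpleGraph.Walk.edges_cons, List.map_cons, List.sum_cons, ih,
      SimpleGraph.Walk.length_cons]
    push_cast
    have h2 : ∀ a : ZMod 2, a + a = 0 := CharTwo.add_self_eq_zero
    by_cases h1 : v = w
    · subst h1
      rw [if_pos rfl, if_neg h]
      linear_combination -h2 ε
    · rw [if_neg h1]
      by_cases h3 : u = w
      · subst h3
        rw [if_pos rfl, Sym2.eq_swap (a := v)]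
        linear_combination h2 (F s(u, v))
      · rw [if_neg h3]
        linear_combination hF u v w h h1 h3 - h2 (F s(u, w)) - h2 ε + h2 ε

end Walks

/-! ### Hamiltonian multisigns in coordinates. -/

section Triangles

variable {V : Type*} [DecidableEq V] {m : ℕ}

theorem triangleMultisign_eq (σ : Multisigning V m) {u v w : V} (h1 : u ≠ v) (h2 : v ≠ w)
    (h3 : u ≠ w) :
    σ.triangleMultisign {u, v, w} = σ s(u, v) + σ s(v, w) + σ s(u, w) := by
  have : ({u, v, w} : Finset V).sym2.filter (fun e => ¬ e.IsDiag) =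
      {s(u, v), s(v, w), s(u, w)} := by
    ext e
    induction e using Sym2.ind with
    | _ a b =>
      simp only [Finset.mem_filter, Finset.mk_mem_sym2_iff, Finset.mem_insert,
        Finset.mem_singleton, Sym2.mk_isDiag_iff, Sym2.eq_iff]
      grind
  rw [triangleMultisign, this, Finset.sum_insert, Finset.sum_insert, Finset.sum_singleton,
    add_assoc]
  · simp only [Finset.mem_singleton, Sym2.eq_iff]; grind
  · simp only [Finset.mem_insert, Finset.mem_singleton, Sym2.eq_iff]; grind

/-- The set of multisigns of Hamiltonian circles, in coordinates with respect to the basis of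
triangle multisigns. -/
theorem exists_hamiltonianMultisigns_bound (hm : 0 < m) : ∃ N : ℕ, 3 ≤ N ∧ ∀ n : ℕ, N ≤ n →
    ∀ (σ : Multisigning (Fin n) m) (b : Module.Basis (Fin m) (ZMod 2) (Fin m → ZMod 2)),
    (∀ t : Finset (Fin n), t.card = 3 → σ.triangleMultisign t ∈ Set.range b) →
    σ.hamiltonianMultisigns = {g |
      (∀ i, b.equivFun g i = 1 → ∃ t : Finset (Fin n), t.card = 3 ∧ σ.triangleMultisign t = b i) ∧
      ∑ i, b.equivFun g i = n} := by
  have : Nonempty (Fin m) := ⟨⟨0, hm⟩⟩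
  obtain ⟨N, hN⟩ := exists_cycleSum_bound (ι := Fin m)
  refine ⟨N + 3, by omega, fun n hn σ b hσ => ?_⟩
  have hb : ∀ i, b.equivFun (b i) = Pi.single i 1 := fun i => by
    ext j; simp [Module.Basis.equivFun_self, Pi.single_apply, eq_comm]
  have htri : ∀ u v w, u ≠ v → v ≠ w → u ≠ w → ∃ i, σ.triangleMultisign {u, v, w} = b i ∧
      b.equivFun (σ s(u, v)) + b.equivFun (σ s(v, w)) + b.equivFun (σ s(u, w)) =
        Pi.single i 1 := by
    intro u v w h1 h2 h3
    obtain ⟨i, hi⟩ := hσ {u, v, w} (Finset.card_eq_three.2 ⟨u, v, w, h1, h3, h2, rfl⟩)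
    refine ⟨i, hi.symm, ?_⟩
    rw [← map_add, ← map_add, ← triangleMultisign_eq σ h1 h2 h3, ← hi, hb]
  ext g
  rw [Set.mem_ofPred_eq]
  constructor
  · rintro ⟨v, c, hc, rfl⟩
    have hlen : c.length = n := by
      rw [hc.length_eq, Fintype.card_fin]
    have hcoord : ∀ i, b.equivFun (σ.circleMultisign c) i =
        (c.edges.map fun e => b.equivFun (σ e) i).sum := by
      intro i
      have := map_list_sum ((LinearMap.proj i : (Fin m → ZMod 2) →ₗ[ZMod 2] ZMod 2) ∘ₗ
        b.equivFun.toLinearMap) (c.edges.map σ)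
      rw [List.map_map] at this
      exact this
    constructor
    · intro i hi
      by_contra hno
      -- An absent color has coordinate 0 on every triangle, hence on every closed walk.
      rw [hcoord, walk_sum_eq _ 0 ?_ c] at hi
      · simp at hi
      · intro u v w h1 h2 h3
        obtain ⟨j, hj, he⟩ := htri u v w h1 h2 h3
        have hij : i ≠ j := fun e =>
          hno ⟨{u, v, w}, Finset.card_eq_three.2 ⟨u, v, w, h1, h3, h2, rfl⟩, e ▸ hj⟩
        have := congrFun he i
        simpa [hij] using this
    · have hsum : ∑ i, b.equivFun (σ.circleMultisign c) i =
          (c.edges.map fun e => ∑ i, b.equivFun (σ e) i).sum := by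
        simp_rw [hcoord]
        generalize c.edges = L
        induction L with
        | nil => simp
        | cons e L ih => simp only [List.map_cons, List.sum_cons, Finset.sum_add_distrib, ih]
      -- The coordinate sum is 1 on every triangle, so on a closed walk it is the length mod 2.
      rw [hsum, walk_sum_eq _ 1 ?_ c, if_pos rfl, hlen, mul_one, add_zero]
      intro u v w h1 h2 h3
      obtain ⟨j, hj, he⟩ := htri u v w h1 h2 h3
      rw [← Finset.sum_add_distrib, ← Finset.sum_add_distrib]
      calc _ = ∑ i, (Pi.single j 1 : Fin m → ZMod 2) i :=
            Finset.sum_congr rfl fun i _ => congrFun he i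
        _ = 1 := by simp
  · rintro ⟨hg, hsum⟩
    -- The values of `σ` on the diagonal are arbitrary and are replaced by 0.
    let s : Fin n → Fin n → Fin m → ZMod 2 := fun u v =>
      if u = v then 0 else b.equivFun (σ s(u, v))
    have hsne : ∀ u v, u ≠ v → s u v = b.equivFun (σ s(u, v)) := fun u v h => if_neg h
    have hstri : ∀ u v w, u ≠ v → v ≠ w → u ≠ w → ∃ i,
        σ.triangleMultisign {u, v, w} = b i ∧ tri s u v w = Pi.single i 1 := by
      intro u v w h1 h2 h3
      obtain ⟨i, hi, he⟩ := htri u v w h1 h2 h3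
      refine ⟨i, hi, ?_⟩
      rw [tri, hsne u v h1, hsne v w h2, hsne w u h3.symm, Sym2.eq_swap (a := w), he]
    have hs : TriangleColored s := by
      refine ⟨fun u v => ?_, fun u => if_pos rfl, fun u v w h1 h2 h3 => ?_⟩
      · by_cases h : u = v
        · rw [h]
        · rw [hsne u v h, hsne v u (Ne.symm h), Sym2.eq_swap]
      · obtain ⟨i, -, hi⟩ := hstri u v w h1 h2 h3
        exact ⟨i, hi⟩
    obtain ⟨f, hf, hfs⟩ := hN hs Finset.univ (b.equivFun g) (by simp; omega) (by
      intro i hi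
      obtain ⟨t, ht, hti⟩ := hg i hi
      obtain ⟨u, v, w, h1, h3, h2, rfl⟩ := Finset.card_eq_three.1 ht
      obtain ⟨j, hj, he⟩ := hstri u v w h1 h2 h3
      have hij : j = i := b.injective (hj.symm.trans hti)
      exact mem_colors.2 ⟨u, by simp, v, by simp, w, by simp, by rw [he, hij]; simp⟩)
      (by simpa using hsum)
    obtain ⟨v, c, hc, hcs⟩ := exists_hamiltonianCycle_of_isCyclicOrder σ hf
      (by rw [Fintype.card_fin]; omega)
    refine ⟨v, c, hc, b.equivFun.injective ?_⟩
    rw [circleMultisign, hcs, map_sum, ← hfs]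
    refine Finset.sum_congr rfl fun u _ => (hsne _ _ ?_).symm
    exact (hf.ne (by simp; omega) (Finset.mem_univ u)).symm

end Triangles

/-! ### The span of differences and the final theorem. -/

/-- Vectors with coordinates summing to zero and supported on `P`, as a span of differences. -/
theorem mem_span_differences_iff {M : Type*} [AddCommGroup M] [Module (ZMod 2) M] {m : ℕ}
    (b : Module.Basis (Fin m) (ZMod 2) M) (P : Fin m → Prop) {i₀ : Fin m} (h₀ : P i₀) (g : M) :
    g ∈ Submodule.span (ZMod 2) {y | ∃ i, i ≠ i₀ ∧ P i ∧ y = b i + b i₀} ↔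
      (∀ i, b.equivFun g i = 1 → P i) ∧ ∑ i, b.equivFun g i = 0 := by
  constructor
  · intro h
    induction h using Submodule.span_induction with
    | mem y hy =>
      obtain ⟨i, hi, hP, rfl⟩ := hy
      constructor
      · intro j hj
        by_contra hno
        have h1 : i ≠ j := fun e => hno (e ▸ hP)
        have h2 : i₀ ≠ j := fun e => hno (e ▸ h₀)
        simp [h1, h2] at hj
      · simp only [map_add, Pi.add_apply, Module.Basis.equivFun_self, Finset.sum_add_distrib]
        simp
        rfl
    | zero => simp
    | add x y _ _ hx hy =>
      constructor
      · intro i hi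
        rcases zmod_two_eq_zero_or_one (b.equivFun x i) with h | h
        · rw [map_add, Pi.add_apply, h, zero_add] at hi
          exact hy.1 i hi
        · exact hx.1 i h
      · simp only [map_add, Pi.add_apply, Finset.sum_add_distrib, hx.2, hy.2, add_zero]
    | smul a x _ hx =>
      rcases zmod_two_eq_zero_or_one a with rfl | rfl
      · simp
      · rwa [one_smul]
  · rintro ⟨h1, h2⟩
    -- The added multiple of `b i₀` is the coordinate sum, which vanishes.
    have hg : g = ∑ i, b.equivFun g i • (b i + b i₀) := by
      simp only [smul_add, Finset.sum_add_distrib]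
      rw [← Finset.sum_smul, h2, zero_smul, add_zero, b.sum_equivFun]
    rw [hg]
    refine Submodule.sum_mem _ fun i _ => ?_
    rcases zmod_two_eq_zero_or_one (b.equivFun g i) with h | h
    · rw [h, zero_smul]; exact Submodule.zero_mem _
    rw [h, one_smul]
    by_cases hi : i = i₀
    · rw [hi, ← two_smul (ZMod 2), show (2 : ZMod 2) = 0 from rfl, zero_smul]
      exact Submodule.zero_mem _
    · exact Submodule.subset_span ⟨i, hi, h1 i h, rfl⟩

end Multisigning

theorem mainTheorem2 (m : ℕ) (hm : 0 < m) :
    ∃ N : ℕ, ∀ n : ℕ, N ≤ n →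
      ∀ (σ : Multisigning (Fin n) m) (x : Fin m → (Fin m → ZMod 2)),
        LinearIndependent (ZMod 2) x →
        (∀ t : Finset (Fin n), t.card = 3 → σ.triangleMultisign t ∈ Set.range x) →
        (∀ i : Fin m, σ.eta (x i) ≤ σ.eta (x ⟨0, hm⟩)) →
        -- if every `x i` is the multisign of a triangle
        ((∀ i : Fin m, ∃ t : Finset (Fin n), t.card = 3 ∧ σ.triangleMultisign t = x i) →
          ∀ U : Submodule (ZMod 2) (Fin m → ZMod 2),
            U = Submodule.span (ZMod 2) {y | ∃ i : Fin m, i ≠ ⟨0, hm⟩ ∧ y = x i + x ⟨0, hm⟩} →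
            (Even n → σ.hamiltonianMultisigns = (U : Set (Fin m → ZMod 2))) ∧
            (Odd n → σ.hamiltonianMultisigns = {g | ∃ u ∈ U, g = x ⟨0, hm⟩ + u})) ∧
        -- in all cases, with only those `x i` that are multisigns of triangles
        (∀ U : Submodule (ZMod 2) (Fin m → ZMod 2),
            U = Submodule.span (ZMod 2) {y | ∃ i : Fin m, i ≠ ⟨0, hm⟩ ∧
              (∃ t : Finset (Fin n), t.card = 3 ∧ σ.triangleMultisign t = x i) ∧
              y = x i + x ⟨0, hm⟩} →
            (Even n → σ.hamiltonianMultisigns = (U : Set (Fin m → ZMod 2))) ∧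
            (Odd n → σ.hamiltonianMultisigns = {g | ∃ u ∈ U, g = x ⟨0, hm⟩ + u})) := by
  have : Nonempty (Fin m) := ⟨⟨0, hm⟩⟩
  obtain ⟨N, hN3, hN⟩ := Multisigning.exists_hamiltonianMultisigns_bound hm
  refine ⟨N, fun n hn σ x hx hσ hη => ?_⟩
  set i₀ : Fin m := ⟨0, hm⟩
  obtain ⟨b, hbx⟩ : ∃ b : Module.Basis (Fin m) (ZMod 2) (Fin m → ZMod 2), ⇑b = x :=
    ⟨basisOfLinearIndependentOfCardEqFinrank hx (by simp),
      coe_basisOfLinearIndependentOfCardEqFinrank hx _⟩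
  subst hbx
  have hS := hN n hn σ b hσ
  let P : Fin m → Prop := fun i =>
    ∃ t : Finset (Fin n), t.card = 3 ∧ σ.triangleMultisign t = b i
  have hPη : ∀ i, P i ↔ 0 < σ.eta (b i) := by
    intro i
    simp [P, Multisigning.eta, Finset.card_pos, Finset.Nonempty, Finset.mem_powersetCard]
  -- Some triangle exists since `n ≥ 3`, so some `η` is positive, and the maximality of `η(x₁)`
  -- makes it positive too.
  have h₀ : P i₀ := by
    obtain ⟨t, ht⟩ := Finset.exists_subset_card_eq
      (show 3 ≤ (Finset.univ : Finset (Fin n)).card by simp; omega)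
    obtain ⟨i, hi⟩ := hσ t ht.2
    rw [hPη]
    exact ((hPη i).1 ⟨t, ht.2, hi.symm⟩).trans_le (hη i)
  have hU := Multisigning.mem_span_differences_iff b P h₀
  have main : ∀ U : Submodule (ZMod 2) (Fin m → ZMod 2),
      U = Submodule.span (ZMod 2) {y | ∃ i : Fin m, i ≠ i₀ ∧ P i ∧ y = b i + b i₀} →
      (Even n → σ.hamiltonianMultisigns = (U : Set (Fin m → ZMod 2))) ∧
      (Odd n → σ.hamiltonianMultisigns = {g | ∃ u ∈ U, g = b i₀ + u}) := by
    rintro U rfl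
    refine ⟨fun he => ?_, fun ho => ?_⟩
    · ext g
      rw [hS, SetLike.mem_coe, hU, Set.mem_ofPred_eq, (ZMod.natCast_eq_zero_iff_even).2 he]
    · ext g
      -- In characteristic 2 translation by `b i₀` is an involution, and it changes the coordinate
      -- sum by 1.
      have hshift : (∃ u ∈ Submodule.span (ZMod 2)
          {y | ∃ i : Fin m, i ≠ i₀ ∧ P i ∧ y = b i + b i₀}, g = b i₀ + u) ↔
          b i₀ + g ∈ Submodule.span (ZMod 2)
            {y | ∃ i : Fin m, i ≠ i₀ ∧ P i ∧ y = b i + b i₀} := by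
        constructor
        · rintro ⟨u, hu, rfl⟩
          rwa [← add_assoc, Multisigning.pi_add_self, zero_add]
        · intro h
          exact ⟨_, h, by rw [← add_assoc, Multisigning.pi_add_self, zero_add]⟩
      rw [hS, Set.mem_ofPred_eq, Set.mem_ofPred_eq, hshift, hU,
        (ZMod.natCast_eq_one_iff_odd).2 ho]
      have hval : ∀ i, b.equivFun (b i₀ + g) i = (if i₀ = i then 1 else 0) + b.equivFun g i := by
        intro i
        rw [map_add, Pi.add_apply, Module.Basis.equivFun_self]
      simp only [hval, Finset.sum_add_distrib]
      refine and_congr (forall_congr' fun i => ?_) ?_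
      · by_cases e : i₀ = i
        · subst e; exact iff_of_true (fun _ => h₀) (fun _ => h₀)
        · rw [if_neg e, zero_add]
      · rw [Finset.sum_ite_eq, if_pos (Finset.mem_univ _)]
        generalize ∑ i, b.equivFun g i = a
        revert a
        decide
  -- Part (a) is the case of part (b) in which `P` holds for every index.
  refine ⟨fun hall U hUe => main U ?_, fun U hUe => main U hUe⟩
  rw [hUe]
  congr 1
  ext y
  exact exists_congr fun i => and_congr_right fun _ => ⟨fun h => ⟨hall i, h⟩, fun h => h.2⟩
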